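/- Let $M\ge 0$ be an integer, $[M]=\{1,\dots,M\}$, and consider an $M$-user discrete memoryless multiple-access channel: finite input alphabets $\mathcal X_1,\dots,\mathcal X_M$, a finite output alphabet $\mathcal Y$, and a stochastic matrix $W(y\mid x_1,\dots,x_M)$. Let $X_1,\dots,X_M$ be independent inputs with distributions $P_{X_1},\dots,P_{X_M}$ on these alphabets, and let $Y$ be the corresponding output, so that $(X_1,\dots,X_M,Y)$ has joint law $\prod_i P_{X_i}(x_i)\,W(y\mid x_1,\dots,x_M)$. Write $X_{\mathcal S}=(X_i)_{i\in\mathcal S}$, $R(\mathcal S)=\sum_{i\in\mathcal S}R_i$ and $\mathcal S^c=[M]\setminus\mathcal S$, and let $$\mathcal R=\{R\in\mathbb R_{\ge0}^M:\ R(\mathcal S)\le I(X_{\mathcal S};Y\mid X_{\mathcal S^c})\ \text{ for all } \mathcal S\subseteq[M]\},$$ where mutual information is measured in bits. Assume that $\mathcal R$ is non-degenerated, that is, 1. $I(X_{\mathcal S};Y)>0$ for every non-empty $\mathcal S\subseteq[M]$, and 2. $I(X_{\mathcal S};Y\mid X_{\mathcal A})<I(X_{\mathcal S};Y\mid X_{\mathcal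 B})$ whenever $\emptyset\ne\mathcal S\subsetneq[M]$, $\mathcal A\subsetneq\mathcal B\subsetneq[M]$ and $\mathcal S\cap\mathcal B=\emptyset$. A face of $\mathcal R$ is a set of the form $\mathcal R\cap\{R:\sum_i R_ia_i=a_0\}$, where $a\in\mathbb R^M$, $a_0\in\mathbb R$ and $\sum_i R_ia_i\le a_0$ holds for all $R\in\mathcal R$ (so $\mathcal R$ itself is a face); an edge is a face whose affine hull has dimension $1$. Then $\mathcal R$ has only finitely many edges, and their number is exactly $$\frac M2\,\lfloor e\,M!\rfloor .$$ -/

import Mathlib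

open scoped Nat

noncomputable section

namespace MAC

/-! ### Finite probability and mutual information (in bits) -/

section Information

variable {Ω α β γ : Type*} [Fintype Ω]

open Classical in
/-- The probability that the random variable `U` takes the value `u`, when outcomes are drawn
according to the probability mass function `P`. -/
def pr (P : Ω → ℝ) (U : Ω → α) (u : α) : ℝ :=
  ∑ ω ∈ Finset.univ.filter (fun ω => U ω = u), P ω

/-- The conditional probability that `U = u` given `Z = z` (used only where `Z = z` has positive
probability). -/
def condPr (P : Ω → ℝ) (U : Ω → α) (Z : Ω → γ) (u : α) (z : γ) : ℝ :=
  pr P (fun ω => (U ω, Z ω)) (u, z) / pr P Z z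

/-- The mutual information `I(U; V) = E [log₂ (p(U,V) / (p(U) p(V)))]`. Outcomes of probability
zero do not contribute. -/
def mutualInfo (P : Ω → ℝ) (U : Ω → α) (V : Ω → β) : ℝ :=
  ∑ ω, P ω * Real.logb 2
    (pr P (fun ω => (U ω, V ω)) (U ω, V ω) / (pr P U (U ω) * pr P V (V ω)))

/-- The conditional mutual information
`I(U; V | Z) = E [log₂ (p(U,V|Z) / (p(U|Z) p(V|Z)))]`. Outcomes of probability zero do not
contribute. -/
def condMutualInfo (P : Ω → ℝ) (U : Ω → α) (V : Ω → β) (Z : Ω → γ) : ℝ :=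
  ∑ ω, P ω * Real.logb 2
    (condPr P (fun ω => (U ω, V ω)) Z (U ω, V ω) (Z ω) /
      (condPr P U Z (U ω) (Z ω) * condPr P V Z (V ω) (Z ω)))

end Information

/-! ### The region of a multiple-access channel -/

section Channel

variable {M : ℕ} {X : Fin M → Type*} {Y : Type*} [∀ i, Fintype (X i)] [Fintype Y]

/-- The joint probability mass function of inputs and output: the inputs are independent with
distributions `P i`, and the channel is the stochastic matrix `W`, whose row `W x` is the
distribution of the output when the inputs are `x`. -/
def jointPMF (W : (∀ i, X i) → stdSimplex ℝ Y) (P : ∀ i, stdSimplex ℝ (X i)) :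
    (∀ i, X i) × Y → ℝ :=
  fun ω => (∏ i, (P i).1 (ω.1 i)) * (W ω.1).1 ω.2

/-- `I(X_S; Y)`, where `X_S = (X_i)_{i ∈ S}`. -/
def info (W : (∀ i, X i) → stdSimplex ℝ Y) (P : ∀ i, stdSimplex ℝ (X i))
    (S : Finset (Fin M)) : ℝ :=
  mutualInfo (jointPMF W P) (fun ω => S.restrict ω.1) (fun ω => ω.2)

/-- `I(X_S; Y | X_A)`. -/
def condInfo (W : (∀ i, X i) → stdSimplex ℝ Y) (P : ∀ i, stdSimplex ℝ (X i))
    (S A : Finset (Fin M)) : ℝ :=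
  condMutualInfo (jointPMF W P) (fun ω => S.restrict ω.1) (fun ω => ω.2)
    (fun ω => A.restrict ω.1)

/-- The region `𝓡[W; P]` of all nonnegative rate tuples `R` with
`∑_{i ∈ S} R_i ≤ I(X_S; Y | X_{Sᶜ})` for every set `S` of users. -/
def region (W : (∀ i, X i) → stdSimplex ℝ Y) (P : ∀ i, stdSimplex ℝ (X i)) :
    Set (Fin M → ℝ) :=
  {R | (∀ i, 0 ≤ R i) ∧ ∀ S : Finset (Fin M), ∑ i ∈ S, R i ≤ condInfo W P S Sᶜ}

/-- The region of `W` and `P` is non-degenerated (all the inclusions `⊂` are strict). -/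
structure NonDegenerated (W : (∀ i, X i) → stdSimplex ℝ Y) (P : ∀ i, stdSimplex ℝ (X i)) :
    Prop where
  info_pos : ∀ S : Finset (Fin M), S.Nonempty → 0 < info W P S
  condInfo_lt : ∀ S A B : Finset (Fin M), S.Nonempty → S ⊂ Finset.univ → A ⊂ B →
    B ⊂ Finset.univ → Disjoint S B → condInfo W P S A < condInfo W P S B

end Channel

/-! ### Faces and edges -/

/-- `F` is a face of `C`: the set of points of `C` at which some linear inequality
`∑ i, R i * a i ≤ a₀` that is valid on all of `C` holds with equality. -/
def IsFace {M : ℕ} (C F : Set (Fin M → ℝ)) : Prop :=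
  ∃ (a : Fin M → ℝ) (a₀ : ℝ), (∀ R ∈ C, ∑ i, R i * a i ≤ a₀) ∧
    F = C ∩ {R | ∑ i, R i * a i = a₀}

/-- `F` is an edge of `C`: a face whose affine hull has dimension one. -/
def IsEdge {M : ℕ} (C F : Set (Fin M → ℝ)) : Prop :=
  IsFace C F ∧ Module.finrank ℝ (affineSpan ℝ F).direction = 1

end MAC

end

/-! By the chain rule, `f S = I(X_S; Y | X_{Sᶜ})` is `info univ - info Sᶜ`, and non-degeneracy says
that `f` is normalized, strictly increasing and strictly submodular on incomparable sets
(`NonDegenerated.isStrictRank`). Only these properties are used afterwards.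

Uncrossing shows that the non-empty sets tight at a point of the polytope form a chain `C`, and
strict monotonicity makes them disjoint from the set `Z` of vanishing coordinates. Such constraints
are linearly independent, and a non-empty face is cut out by the constraints tight at a generic
point of it, so its dimension is `M - |C| - |Z|`. Edges thus give pairs with `|C| + |Z| = M - 1`
(`edgePairs`). Conversely, each such pair is exactly the tight data of some point
(`exists_point_of_mem_edgePairs`), so edges and pairs are in bijection.

To count the pairs, fix the union `A` of `C`, with `|A| = a`. Either `C` is one of `a!` saturated
chains and `Z` omits one of the `M - a` remaining elements, or `C` is one of `(a - 1) a! / 2` chains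
with one member fewer and `Z = Aᶜ`. Summing over `A` and telescoping, twice the count is `M ∑ k ≤ M,
M.descFactorial k`, and this sum is `⌊e M!⌋` for `M ≥ 1`. -/

open scoped Nat

namespace MAC

/-! ### Chain rule for mutual information -/

section InfoRank

variable {Ω α β γ δ : Type*} [Fintype Ω]

theorem pr_pos_of_pos {P : Ω → ℝ} (hP : ∀ ω, 0 ≤ P ω) (U : Ω → α) {ω : Ω} (h : 0 < P ω) :
    0 < pr P U (U ω) := by
  classical
  unfold pr
  exact Finset.sum_pos' (fun i _ => hP i) ⟨ω, by simp, h⟩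

theorem pr_congr_of_iff (P : Ω → ℝ) (U : Ω → α) (V : Ω → β) (u : α) (v : β)
    (h : ∀ ω, U ω = u ↔ V ω = v) : pr P U u = pr P V v := by
  classical
  unfold pr
  refine Finset.sum_congr ?_ fun _ _ => rfl
  ext ω
  simp [h]

/-- The chain rule `I(U; V | Z) = I((U, Z); V) - I(Z; V)`, where `T` carries the same
information as the pair `(U, Z)`. -/
theorem condMutualInfo_eq_sub {P : Ω → ℝ} (hP : ∀ ω, 0 ≤ P ω) (U : Ω → α) (V : Ω → β)
    (Z : Ω → γ) (T : Ω → δ) (hT : ∀ ω ω', T ω' = T ω ↔ U ω' = U ω ∧ Z ω' = Z ω) :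
    condMutualInfo P U V Z = mutualInfo P T V - mutualInfo P Z V := by
  unfold condMutualInfo mutualInfo
  rw [← Finset.sum_sub_distrib]
  refine Finset.sum_congr rfl fun ω _ => ?_
  rcases (hP ω).eq_or_lt with h0 | hpos
  · simp [← h0]
  rw [← mul_sub]
  congr 1
  unfold condPr
  rw [pr_congr_of_iff P (fun ω => ((U ω, V ω), Z ω)) (fun ω => (T ω, V ω)) _ (T ω, V ω)
      (by intro ω'; simp only [Prod.mk.injEq, hT]; tauto),
    pr_congr_of_iff P (fun ω => (U ω, Z ω)) T _ (T ω)
      (by intro ω'; simp only [Prod.mk.injEq, hT]),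
    pr_congr_of_iff P (fun ω => (V ω, Z ω)) (fun ω => (Z ω, V ω)) _ (Z ω, V ω)
      (by intro ω'; simp only [Prod.mk.injEq]; tauto)]
  have h1 : 0 < pr P (fun ω => (T ω, V ω)) (T ω, V ω) := pr_pos_of_pos hP _ hpos
  have h2 : 0 < pr P T (T ω) := pr_pos_of_pos hP _ hpos
  have h3 : 0 < pr P (fun ω => (Z ω, V ω)) (Z ω, V ω) := pr_pos_of_pos hP _ hpos
  have h4 : 0 < pr P Z (Z ω) := pr_pos_of_pos hP _ hpos
  have h5 : 0 < pr P V (V ω) := pr_pos_of_pos hP _ hpos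
  rw [← Real.logb_div (by positivity) (by positivity)]
  congr 1
  field_simp

end InfoRank

/-! ### Conditional information as a difference of values of `info` -/

section ChannelRank

variable {M : ℕ} {X : Fin M → Type*} {Y : Type*} [∀ i, Fintype (X i)] [Fintype Y]

theorem jointPMF_nonneg (W : (∀ i, X i) → stdSimplex ℝ Y) (P : ∀ i, stdSimplex ℝ (X i))
    (ω : (∀ i, X i) × Y) : 0 ≤ jointPMF W P ω :=
  mul_nonneg (Finset.prod_nonneg fun i _ => (P i).2.1 _) ((W ω.1).2.1 _)

theorem sum_jointPMF (W : (∀ i, X i) → stdSimplex ℝ Y) (P : ∀ i, stdSimplex ℝ (X i)) :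
    ∑ ω, jointPMF W P ω = 1 := by
  classical
  unfold jointPMF
  rw [Fintype.sum_prod_type]
  simp only [← Finset.mul_sum, (W _).2.2, mul_one]
  rw [← Fintype.piFinset_univ,
    ← Finset.prod_univ_sum (fun i => Finset.univ) (fun i x => (P i).1 x)]
  exact Finset.prod_eq_one fun i _ => (P i).2.2

theorem condInfo_eq_sub (W : (∀ i, X i) → stdSimplex ℝ Y) (P : ∀ i, stdSimplex ℝ (X i))
    (S A : Finset (Fin M)) : condInfo W P S A = info W P (S ∪ A) - info W P A := by
  refine condMutualInfo_eq_sub (jointPMF_nonneg W P) _ _ _ _ fun ω ω' => ?_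
  simp only [funext_iff, Finset.restrict, Subtype.forall, Finset.mem_union]
  grind

theorem info_empty (W : (∀ i, X i) → stdSimplex ℝ Y) (P : ∀ i, stdSimplex ℝ (X i)) :
    info W P ∅ = 0 := by
  unfold info mutualInfo
  refine Finset.sum_eq_zero fun ω _ => ?_
  rcases (jointPMF_nonneg W P ω).eq_or_lt with h0 | hpos
  · simp [← h0]
  have h1 : ∀ u, pr (jointPMF W P) (fun ω => (∅ : Finset (Fin M)).restrict ω.1) u = 1 := by
    intro u
    rw [← sum_jointPMF W P]
    unfold pr
    congr 1
    ext ω'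
    simpa using Subsingleton.elim _ _
  rw [h1, pr_congr_of_iff _ (fun ω : (∀ i, X i) × Y => ((∅ : Finset (Fin M)).restrict ω.1, ω.2))
    (fun ω => ω.2) _ ω.2 (by
      intro ω'
      simp only [Prod.mk.injEq, and_iff_right_iff_imp]
      exact fun _ => Subsingleton.elim _ _)]
  have h5 : 0 < pr (jointPMF W P) (fun ω => ω.2) ω.2 :=
    pr_pos_of_pos (jointPMF_nonneg W P) (fun ω : (∀ i, X i) × Y => ω.2) hpos
  rw [one_mul, div_self h5.ne']
  simp

end ChannelRank

/-- A normalized set function that is strictly increasing, and strictly submodular on pairs of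
incomparable sets. -/
structure IsStrictRank {ι : Type*} [DecidableEq ι] (f : Finset ι → ℝ) : Prop where
  empty : f ∅ = 0
  strictMono : StrictMono f
  submod : ∀ S T : Finset ι, ¬ S ⊆ T → ¬ T ⊆ S → f (S ∪ T) + f (S ∩ T) < f S + f T

/-- For `S ⊂ T` the increment is `I(X_{T \ S}; Y | X_{Tᶜ})`, which is at least `I(X_{T \ S}; Y) >
0`. The submodularity gap is the difference of `I(X_{S \ T}; Y | ·)` given `Sᶜ` and given `(S ∪
T)ᶜ`; incomparability supplies the properness conditions of `condInfo_lt`. -/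
theorem NonDegenerated.isStrictRank {M : ℕ} {X : Fin M → Type*} {Y : Type*}
    [∀ i, Fintype (X i)] [Fintype Y] {W : (∀ i, X i) → stdSimplex ℝ Y}
    {P : ∀ i, stdSimplex ℝ (X i)} (h : NonDegenerated W P) :
    IsStrictRank fun S : Finset (Fin M) => condInfo W P S Sᶜ := by
  have key : ∀ S : Finset (Fin M),
      condInfo W P S Sᶜ = info W P Finset.univ - info W P Sᶜ := fun S => by
    rw [condInfo_eq_sub, Finset.union_compl]
  refine ⟨by rw [key]; simp, fun S T hST => ?_, fun S T h1 h2 => ?_⟩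
  · have hST' := Finset.ssubset_iff_subset_ne.1 hST
    obtain ⟨x, hxT, hxS⟩ := Finset.exists_of_ssubset hST
    have hD : (T \ S).Nonempty := ⟨x, by simp [hxT, hxS]⟩
    have e1 : T \ S ∪ Tᶜ = Sᶜ := by
      ext y
      have := @hST'.1 y
      simp only [Finset.mem_union, Finset.mem_sdiff, Finset.mem_compl]
      tauto
    have e2 := condInfo_eq_sub W P (T \ S) Tᶜ
    rw [e1] at e2
    have hpos : 0 < condInfo W P (T \ S) Tᶜ := by
      have hi := h.info_pos _ hD
      have e0 := condInfo_eq_sub W P (T \ S) ∅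
      rw [Finset.union_empty, info_empty, sub_zero] at e0
      -- If `Tᶜ = ∅` the conditioning is void and `condInfo_lt` does not apply; `info_pos` alone
      -- suffices.
      rcases Finset.eq_empty_or_nonempty Tᶜ with hT | hT
      · rw [hT, e0]
        exact hi
      · refine hi.trans ?_
        rw [← e0]
        refine h.condInfo_lt _ _ _ hD ?_ ?_ ?_ ?_
        · obtain ⟨y, hy⟩ := hT
          refine (Finset.ssubset_univ_iff).2 fun hu => ?_
          have : y ∈ T \ S := hu ▸ Finset.mem_univ y
          exact Finset.mem_compl.1 hy (Finset.mem_sdiff.1 this).1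
        · exact Finset.empty_ssubset.2 hT
        · refine (Finset.ssubset_univ_iff).2 fun hu => ?_
          have : x ∈ Tᶜ := hu ▸ Finset.mem_univ x
          simp_all
        · exact Finset.disjoint_left.2 fun y hy => by simp_all
    simp only [key]
    linarith
  · obtain ⟨x, hxS, hxT⟩ := Finset.not_subset.1 h1
    obtain ⟨y, hyT, hyS⟩ := Finset.not_subset.1 h2
    have hlt := h.condInfo_lt (S \ T) (S ∪ T)ᶜ Sᶜ ⟨x, by simp [hxS, hxT]⟩
      (Finset.ssubset_univ_iff.2 fun hu => by
        have : y ∈ S \ T := hu ▸ Finset.mem_univ y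
        exact hyS (Finset.mem_sdiff.1 this).1)
      (Finset.ssubset_iff_subset_ne.2 ⟨by
        intro z; simp; tauto, fun hu => by
        have : y ∈ (S ∪ T)ᶜ := hu ▸ (by simpa using hyS)
        simp_all⟩)
      (Finset.ssubset_univ_iff.2 fun hu => by
        have : x ∈ Sᶜ := hu ▸ Finset.mem_univ x
        simp_all)
      (Finset.disjoint_left.2 fun y hy => by simp_all)
    rw [condInfo_eq_sub, condInfo_eq_sub,
      show S \ T ∪ (S ∪ T)ᶜ = Tᶜ by ext z; simp; tauto,
      show S \ T ∪ Sᶜ = (S ∩ T)ᶜ by ext z; simp; tauto] at hlt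
    simp only [key]
    linarith

/-! ### Tight constraints and dimension of faces -/

section Polytope

open Filter Topology

variable {ι : Type*} [Fintype ι] [DecidableEq ι] {f : Finset ι → ℝ} {R Q v : ι → ℝ}

/-- The polytope of nonnegative vectors whose sum over every set `S` is at most `f S`. -/
def polytope (f : Finset ι → ℝ) : Set (ι → ℝ) :=
  {R | (∀ i, 0 ≤ R i) ∧ ∀ S, ∑ i ∈ S, R i ≤ f S}

open Classical in
/-- The non-empty sets whose constraint is tight at `R`. -/
noncomputable def tightSets (f : Finset ι → ℝ) (R : ι → ℝ) : Finset (Finset ι) :=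
  Finset.univ.filter fun S => S.Nonempty ∧ ∑ i ∈ S, R i = f S

open Classical in
/-- The coordinates at which `R` vanishes. -/
noncomputable def zeros (R : ι → ℝ) : Finset ι :=
  Finset.univ.filter fun i => R i = 0

omit [DecidableEq ι] in
theorem mem_tightSets {S : Finset ι} :
    S ∈ tightSets f R ↔ S.Nonempty ∧ ∑ i ∈ S, R i = f S := by
  simp [tightSets]

omit [DecidableEq ι] in
theorem mem_zeros {i : ι} : i ∈ zeros R ↔ R i = 0 := by
  simp [zeros]

/-- The points of the polytope at which the sets in `C` are tight and the coordinates in `Z`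
vanish. -/
def faceOf (f : Finset ι → ℝ) (C : Finset (Finset ι)) (Z : Finset ι) : Set (ι → ℝ) :=
  {R ∈ polytope f | (∀ S ∈ C, ∑ i ∈ S, R i = f S) ∧ ∀ i ∈ Z, R i = 0}

/-- The linear subspace of vectors whose sums over the sets in `C` and whose coordinates in `Z`
vanish. -/
def faceDirection (C : Finset (Finset ι)) (Z : Finset ι) : Submodule ℝ (ι → ℝ) where
  carrier := {v | (∀ S ∈ C, ∑ i ∈ S, v i = 0) ∧ ∀ i ∈ Z, v i = 0}
  add_mem' := by
    rintro v w ⟨h1, h2⟩ ⟨h3, h4⟩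
    refine ⟨fun S hS => ?_, fun i hi => ?_⟩
    · simp [Finset.sum_add_distrib, h1 S hS, h3 S hS]
    · simp [h2 i hi, h4 i hi]
  zero_mem' := by simp
  smul_mem' := by
    rintro c v ⟨h1, h2⟩
    refine ⟨fun S hS => ?_, fun i hi => ?_⟩
    · simp [← Finset.mul_sum, h1 S hS]
    · simp [h2 i hi]

omit [Fintype ι] [DecidableEq ι] in
theorem mem_faceDirection {C : Finset (Finset ι)} {Z : Finset ι} :
    v ∈ faceDirection C Z ↔ (∀ S ∈ C, ∑ i ∈ S, v i = 0) ∧ ∀ i ∈ Z, v i = 0 :=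
  Iff.rfl

/-- Uncrossing: if tight `S`, `T` were incomparable, strict submodularity would make `S ∪ T` or `S ∩
T` violate its constraint. -/
theorem IsStrictRank.isChain_tightSets (hf : IsStrictRank f) (hR : R ∈ polytope f) :
    IsChain (· ⊆ ·) (tightSets f R : Set (Finset ι)) := by
  intro S hS T hT _
  rw [Finset.mem_coe, mem_tightSets] at hS hT
  by_contra h
  rw [not_or] at h
  have h1 := hf.submod S T h.1 h.2
  have h2 := Finset.sum_union_inter (s₁ := S) (s₂ := T) (f := R)
  have h3 := hR.2 (S ∪ T)
  have h4 := hR.2 (S ∩ T)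
  linarith [hS.2, hT.2]

/-- Deleting a vanishing coordinate from a tight set keeps the sum but strictly lowers `f`. -/
theorem IsStrictRank.disjoint_zeros (hf : IsStrictRank f) (hR : R ∈ polytope f) {S : Finset ι}
    (hS : S ∈ tightSets f R) : Disjoint S (zeros R) := by
  rw [mem_tightSets] at hS
  refine Finset.disjoint_left.2 fun i hi hz => ?_
  rw [mem_zeros] at hz
  have h1 := hR.2 (S.erase i)
  have h2 := hf.strictMono (Finset.erase_ssubset hi)
  have h3 := Finset.sum_erase_add S R hi
  linarith [hS.2]

-- Moving along `v` leaves the tight constraints tight, and the finitely many slack ones stay slack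
-- for small `ε` of either sign.
omit [DecidableEq ι] in
theorem eventually_add_smul_mem (hR : R ∈ polytope f)
    (hv : v ∈ faceDirection (tightSets f R) (zeros R)) :
    ∀ᶠ ε : ℝ in 𝓝 0, R + ε • v ∈ polytope f := by
  have h1 : ∀ᶠ ε : ℝ in 𝓝 0, ∀ i, 0 ≤ (R + ε • v) i := by
    refine eventually_all.2 fun i => ?_
    rcases (hR.1 i).eq_or_lt with h | h
    · simp [hv.2 i (mem_zeros.2 h.symm), ← h]
    · have hc : ContinuousAt (fun ε : ℝ => (R + ε • v) i) 0 := by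
        simp only [Pi.add_apply, Pi.smul_apply, smul_eq_mul]
        fun_prop
      have : 0 < (R + (0 : ℝ) • v) i := by simpa using h
      filter_upwards [continuousAt_const.eventually_lt hc this] with ε hε using hε.le
  have h2 : ∀ᶠ ε : ℝ in 𝓝 0, ∀ S : Finset ι, ∑ i ∈ S, (R + ε • v) i ≤ f S := by
    refine eventually_all.2 fun S => ?_
    rcases S.eq_empty_or_nonempty with rfl | hne
    · simpa using hR.2 ∅
    rcases (hR.2 S).eq_or_lt with h | h
    · simp [Finset.sum_add_distrib, ← Finset.mul_sum, hv.1 S (mem_tightSets.2 ⟨hne, h⟩), h]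
    · have hc : ContinuousAt (fun ε : ℝ => ∑ i ∈ S, (R + ε • v) i) 0 := by
        simp only [Pi.add_apply, Pi.smul_apply, smul_eq_mul]
        fun_prop
      have : ∑ i ∈ S, (R + (0 : ℝ) • v) i < f S := by simpa using h
      filter_upwards [hc.eventually_lt continuousAt_const this] with ε hε using hε.le
  filter_upwards [h1, h2] with ε h3 h4 using ⟨h3, h4⟩

omit [DecidableEq ι] in
theorem add_smul_mem_faceOf (hv : v ∈ faceDirection (tightSets f R) (zeros R)) {ε : ℝ}
    (h : R + ε • v ∈ polytope f) : R + ε • v ∈ faceOf f (tightSets f R) (zeros R) := by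
  refine ⟨h, fun S hS => ?_, fun i hi => ?_⟩
  · simp [Finset.sum_add_distrib, ← Finset.mul_sum, hv.1 S hS, (mem_tightSets.1 hS).2]
  · simp [hv.2 i hi, mem_zeros.1 hi]

omit [DecidableEq ι] in
theorem mem_faceOf_self (hR : R ∈ polytope f) : R ∈ faceOf f (tightSets f R) (zeros R) :=
  ⟨hR, fun _ hS => (mem_tightSets.1 hS).2, fun _ hi => mem_zeros.1 hi⟩

omit [Fintype ι] [DecidableEq ι] in
theorem sub_mem_faceDirection {C : Finset (Finset ι)} {Z : Finset ι} (hR : R ∈ faceOf f C Z)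
    (hQ : Q ∈ faceOf f C Z) : R - Q ∈ faceDirection C Z := by
  refine ⟨fun S hS => ?_, fun i hi => ?_⟩
  · simp [hR.2.1 S hS, hQ.2.1 S hS]
  · simp [hR.2.2 i hi, hQ.2.2 i hi]

omit [DecidableEq ι] in
theorem direction_affineSpan_faceOf (hR : R ∈ polytope f) :
    (affineSpan ℝ (faceOf f (tightSets f R) (zeros R))).direction =
      faceDirection (tightSets f R) (zeros R) := by
  rw [direction_affineSpan]
  refine le_antisymm (Submodule.span_le.2 ?_) fun v hv => ?_
  · rintro _ ⟨P, hP, Q, hQ, rfl⟩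
    exact sub_mem_faceDirection hP hQ
  · have hpos := (eventually_add_smul_mem hR hv).filter_mono (nhdsWithin_le_nhds (s := Set.Ioi 0))
    obtain ⟨ε, hε, hε0⟩ := (hpos.and self_mem_nhdsWithin).exists
    have h1 := vsub_mem_vectorSpan ℝ (add_smul_mem_faceOf hv hε) (mem_faceOf_self hR)
    have h2 := Submodule.smul_mem _ ε⁻¹ h1
    have hne : ε ≠ 0 := (Set.mem_Ioi.1 hε0).ne'
    simpa [smul_smul, hne] using h2

/-- A convex non-empty part of the polytope has a point at which no constraint is tight that is
not tight everywhere. -/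
theorem exists_generic_point {F : Set (ι → ℝ)} (hF : F ⊆ polytope f) (hconv : Convex ℝ F)
    (hne : F.Nonempty) :
    ∃ R ∈ F, ∀ Q ∈ F, tightSets f R ⊆ tightSets f Q ∧ zeros R ⊆ zeros Q := by
  -- Take `R` with fewest tight constraints. A constraint tight at the midpoint of `R` and `Q` is
  -- tight at both, so minimality forces those of `R` to be tight at `Q`.
  obtain ⟨R, hR, hmin⟩ := exists_minimalFor_of_wellFoundedLT (fun R => R ∈ F)
    (fun R => (tightSets f R).card + (zeros R).card) hne
  refine ⟨R, hR, fun Q hQ => ?_⟩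
  set P : ι → ℝ := (2⁻¹ : ℝ) • R + (2⁻¹ : ℝ) • Q with hP
  have hPF : P ∈ F := hconv hR hQ (by norm_num) (by norm_num) (by norm_num)
  have hsum : ∀ S : Finset ι, ∑ i ∈ S, P i = 2⁻¹ * ∑ i ∈ S, R i + 2⁻¹ * ∑ i ∈ S, Q i := by
    intro S
    simp [hP, Finset.sum_add_distrib, Finset.mul_sum]
  have ht : tightSets f P ⊆ tightSets f R ∩ tightSets f Q := by
    intro S hS
    rw [Finset.mem_inter, mem_tightSets, mem_tightSets]
    rw [mem_tightSets, hsum] at hS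
    have h1 := (hF hR).2 S
    have h2 := (hF hQ).2 S
    exact ⟨⟨hS.1, by linarith [hS.2]⟩, hS.1, by linarith [hS.2]⟩
  have hz : zeros P ⊆ zeros R ∩ zeros Q := by
    intro i hi
    rw [Finset.mem_inter, mem_zeros, mem_zeros]
    rw [mem_zeros, hP] at hi
    simp only [Pi.add_apply, Pi.smul_apply, smul_eq_mul] at hi
    have h1 := (hF hR).1 i
    have h2 := (hF hQ).1 i
    exact ⟨by linarith, by linarith⟩
  have ht1 := Finset.card_le_card (ht.trans Finset.inter_subset_left)
  have hz1 := Finset.card_le_card (hz.trans Finset.inter_subset_left)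
  have hm := hmin (j := P) hPF (by simp only; omega)
  simp only at hm
  have ht2 := Finset.eq_of_subset_of_card_le (ht.trans Finset.inter_subset_left) (by omega)
  have hz2 := Finset.eq_of_subset_of_card_le (hz.trans Finset.inter_subset_left) (by omega)
  exact ⟨ht2 ▸ ht.trans Finset.inter_subset_right, hz2 ▸ hz.trans Finset.inter_subset_right⟩

/-- The system is triangular: each member of the chain has an element lying in no smaller member and
not in `Z`. Evaluating a relation there kills the coefficient of the largest member that occurs. -/
theorem linearIndependent_constraints {C : Finset (Finset ι)} {Z : Finset ι}
    (hC : IsChain (· ⊆ ·) (C : Set (Finset ι))) (h0 : ∅ ∉ C) (hZ : ∀ S ∈ C, Disjoint S Z) :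
    LinearIndependent ℝ (Sum.elim (fun (S : C) (i : ι) => if i ∈ S.1 then (1 : ℝ) else 0)
      (fun z : Z => Pi.single z.1 (1 : ℝ))) := by
  rw [Fintype.linearIndependent_iff]
  intro g hg
  have hg' : ∀ j, (∑ S : C, g (Sum.inl S) * if j ∈ S.1 then (1 : ℝ) else 0) +
      ∑ z : Z, g (Sum.inr z) * (Pi.single z.1 (1 : ℝ) : ι → ℝ) j = 0 := by
    intro j
    have := congrFun hg j
    simpa [Fintype.sum_sum_type] using this
  have hnotZ : ∀ j, j ∉ Z → ∑ z : Z, g (Sum.inr z) * (Pi.single z.1 (1 : ℝ) : ι → ℝ) j = 0 := by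
    intro j hj
    refine Finset.sum_eq_zero fun z _ => ?_
    rw [Pi.single_eq_of_ne (by rintro rfl; exact hj z.2), mul_zero]
  have hCz : ∀ S : C, g (Sum.inl S) = 0 := by
    by_contra hcon
    push Not at hcon
    obtain ⟨S, hS, hmax⟩ := (Finset.univ.filter fun S : C => g (Sum.inl S) ≠ 0).exists_max_image
      (fun S => S.1.card) (by
        obtain ⟨S, hS⟩ := hcon
        exact ⟨S, by simpa using hS⟩)
    have hSne : S.1.Nonempty := Finset.nonempty_iff_ne_empty.2 fun h => h0 (h ▸ S.2)
    -- Otherwise the smaller members would cover `S`, hence the largest of them, a proper subset,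
    -- would.
    obtain ⟨x, hxS, hx⟩ : ∃ x ∈ S.1, ∀ T ∈ C, T ⊂ S.1 → x ∉ T := by
      by_contra hno
      push Not at hno
      let D := C.filter fun T => T ⊂ S.1
      obtain ⟨y, hy⟩ := hSne
      obtain ⟨T0, hT0, hT0S, -⟩ := hno y hy
      have hDne : D.Nonempty := ⟨T0, by simp [D, hT0, hT0S]⟩
      obtain ⟨T, hT, hTmax⟩ := D.exists_max_image Finset.card hDne
      simp only [D, Finset.mem_filter] at hT hTmax
      obtain ⟨z, hzS, hzT⟩ := Finset.exists_of_ssubset hT.2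
      obtain ⟨U, hU, hUS, hzU⟩ := hno z hzS
      rcases hC.total hT.1 hU with h | h
      · exact hzT ((Finset.eq_of_subset_of_card_le h (hTmax U ⟨hU, hUS⟩)) ▸ hzU)
      · exact hzT (h hzU)
    have h1 := hg' x
    rw [hnotZ x (Finset.disjoint_left.1 (hZ S S.2) hxS), add_zero, Finset.sum_eq_single S] at h1
    · rw [if_pos hxS, mul_one] at h1
      exact (Finset.mem_filter.1 hS).2 h1
    · intro T _ hTS
      by_cases hT : g (Sum.inl T) = 0
      · rw [hT, zero_mul]
      have hcard := hmax T (by simpa using hT)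
      have hne : T.1 ≠ S.1 := fun h => hTS (Subtype.ext h)
      rcases hC.total T.2 S.2 with h | h
      · rw [if_neg (hx T T.2 (Finset.ssubset_iff_subset_ne.2 ⟨h, hne⟩)), mul_zero]
      · exact absurd (Finset.eq_of_subset_of_card_le h hcard).symm hne
    · simp
  rintro (S | z)
  · exact hCz S
  · have h1 := hg' z
    rw [Finset.sum_eq_zero fun S _ => by rw [hCz, zero_mul], zero_add,
      Finset.sum_eq_single z] at h1
    · simpa using h1
    · intro w _ hw
      rw [Pi.single_eq_of_ne (fun h => hw (Subtype.ext h.symm)), mul_zero]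
    · simp

theorem finrank_faceDirection {C : Finset (Finset ι)} {Z : Finset ι}
    (hC : IsChain (· ⊆ ·) (C : Set (Finset ι))) (h0 : ∅ ∉ C) (hZ : ∀ S ∈ C, Disjoint S Z) :
    C.card + Z.card + Module.finrank ℝ (faceDirection C Z) = Fintype.card ι := by
  let A : Matrix (C ⊕ Z) ι ℝ := Sum.elim (fun (S : C) (i : ι) => if i ∈ S.1 then (1 : ℝ) else 0)
      (fun z : Z => Pi.single z.1 (1 : ℝ))
  have hrank : A.rank = Fintype.card (C ⊕ Z) :=
    LinearIndependent.rank_matrix (linearIndependent_constraints hC h0 hZ)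
  have hker : faceDirection C Z = LinearMap.ker A.mulVecLin := by
    ext v
    rw [mem_faceDirection, LinearMap.mem_ker, Matrix.mulVecLin_apply, funext_iff, Sum.forall]
    simp [A, Matrix.mulVec, dotProduct, Pi.single_apply]
  have h := A.mulVecLin.finrank_range_add_finrank_ker
  rw [← Matrix.rank, hrank, ← hker, Module.finrank_fintype_fun_eq_card] at h
  simpa using h

end Polytope

/-! ### Non-empty faces are cut out by tight constraints -/

section Face

variable {M : ℕ} {f : Finset (Fin M) → ℝ}

/-- Adding up the constraints in `C` and `Z` gives one valid inequality, an equality exactly when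
every summand is. -/
theorem isFace_faceOf (f : Finset (Fin M) → ℝ) (C : Finset (Finset (Fin M)))
    (Z : Finset (Fin M)) : IsFace (polytope f) (faceOf f C Z) := by
  have key : ∀ R : Fin M → ℝ,
      ∑ i, R i * ((∑ S ∈ C, if i ∈ S then (1 : ℝ) else 0) - if i ∈ Z then 1 else 0) =
        ∑ S ∈ C, ∑ i ∈ S, R i - ∑ i ∈ Z, R i := by
    intro R
    simp only [mul_sub, Finset.sum_sub_distrib, Finset.mul_sum]
    rw [Finset.sum_comm]
    simp
  refine ⟨fun i => (∑ S ∈ C, if i ∈ S then (1 : ℝ) else 0) - if i ∈ Z then 1 else 0,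
    ∑ S ∈ C, f S, fun R hR => ?_, ?_⟩
  · rw [key]
    have h1 := Finset.sum_le_sum fun S (_ : S ∈ C) => hR.2 S
    have h2 := Finset.sum_nonneg fun i (_ : i ∈ Z) => hR.1 i
    linarith
  · ext R
    simp only [Set.mem_inter_iff, Set.mem_ofPred_eq, key, faceOf]
    refine and_congr_right fun hR => ?_
    have h1 := Finset.sum_le_sum fun S (_ : S ∈ C) => hR.2 S
    have h2 := Finset.sum_nonneg fun i (_ : i ∈ Z) => hR.1 i
    rw [← Finset.sum_eq_sum_iff_of_le fun S (_ : S ∈ C) => hR.2 S,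
      ← Finset.sum_eq_zero_iff_of_nonneg fun i (_ : i ∈ Z) => hR.1 i]
    constructor
    · rintro ⟨h3, h4⟩
      rw [h3, h4, sub_zero]
    · intro h
      exact ⟨by linarith, by linarith⟩

open Filter Topology in
theorem IsFace.exists_eq_faceOf {F : Set (Fin M → ℝ)} (hF : IsFace (polytope f) F)
    (hne : F.Nonempty) : ∃ R ∈ polytope f, F = faceOf f (tightSets f R) (zeros R) := by
  obtain ⟨a, a₀, hle, rfl⟩ := hF
  have hconv : Convex ℝ (polytope f ∩ {R : Fin M → ℝ | ∑ i, R i * a i = a₀}) := by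
    have hlin : ∀ (R Q : Fin M → ℝ) (s t : ℝ) (S : Finset (Fin M)) (b : Fin M → ℝ),
        ∑ i ∈ S, (s • R + t • Q) i * b i =
          s * ∑ i ∈ S, R i * b i + t * ∑ i ∈ S, Q i * b i := by
      intro R Q s t S b
      simp only [Pi.add_apply, Pi.smul_apply, smul_eq_mul, add_mul, Finset.sum_add_distrib,
        Finset.mul_sum, mul_assoc]
    intro R hR Q hQ s t hs ht hst
    refine ⟨⟨fun i => ?_, fun S => ?_⟩, ?_⟩
    · have h1 := mul_nonneg hs (hR.1.1 i)
      have h2 := mul_nonneg ht (hQ.1.1 i)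
      simpa using add_nonneg h1 h2
    · have h := hlin R Q s t S fun _ => 1
      simp only [mul_one] at h
      rw [h]
      have h1 := mul_le_mul_of_nonneg_left (hR.1.2 S) hs
      have h2 := mul_le_mul_of_nonneg_left (hQ.1.2 S) ht
      have h3 : s * f S + t * f S = f S := by rw [← add_mul, hst, one_mul]
      linarith
    · rw [Set.mem_ofPred_eq, hlin, hR.2, hQ.2, ← add_mul, hst, one_mul]
  obtain ⟨R, hR, hgen⟩ := exists_generic_point (f := f) Set.inter_subset_left hconv hne
  refine ⟨R, hR.1, Set.Subset.antisymm (fun Q hQ => ?_) fun Q hQ => ⟨hQ.1, ?_⟩⟩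
  · exact ⟨hQ.1, fun S hS => (mem_tightSets.1 ((hgen Q hQ).1 hS)).2,
      fun i hi => mem_zeros.1 ((hgen Q hQ).2 hi)⟩
  -- From the generic `R`, a small step away from `Q` stays in the polytope; validity of the
  -- inequality there forces its value at `Q` up to `a₀`.
  · have hv := sub_mem_faceDirection (mem_faceOf_self hR.1) hQ
    have hpos := (eventually_add_smul_mem hR.1 hv).filter_mono
      (nhdsWithin_le_nhds (s := Set.Ioi 0))
    obtain ⟨ε, hε, hε0⟩ := (hpos.and self_mem_nhdsWithin).exists
    have h1 := hle _ hε
    have h2 : ∑ i, (R + ε • (R - Q)) i * a i =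
        ∑ i, R i * a i + ε * (∑ i, R i * a i - ∑ i, Q i * a i) := by
      rw [← Finset.sum_sub_distrib, Finset.mul_sum, ← Finset.sum_add_distrib]
      refine Finset.sum_congr rfl fun i _ => ?_
      simp
      ring
    have h3 : ∑ i, R i * a i = a₀ := hR.2
    rw [h2, h3] at h1
    have h4 : ε * (a₀ - ∑ i, Q i * a i) ≤ 0 := by linarith
    have h5 : a₀ - ∑ i, Q i * a i ≤ 0 := nonpos_of_mul_nonpos_right h4 hε0
    exact le_antisymm (hle Q hQ.1) (by linarith)

end Face

/-! ### Counting chains and pairs -/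

section Count

variable {α : Type*}

open Classical in
/-- The chains of `k` non-empty sets with union `A`. -/
noncomputable def chainsWithSup [Fintype α] [DecidableEq α] (A : Finset α) (k : ℕ) : Finset (Finset (Finset α)) :=
  Finset.univ.filter fun C =>
    IsChain (· ⊆ ·) (C : Set (Finset α)) ∧ ∅ ∉ C ∧ C.sup id = A ∧ C.card = k

theorem mem_chainsWithSup [Fintype α] [DecidableEq α] {A : Finset α} {k : ℕ} {C : Finset (Finset α)} :
    C ∈ chainsWithSup A k ↔
      IsChain (· ⊆ ·) (C : Set (Finset α)) ∧ ∅ ∉ C ∧ C.sup id = A ∧ C.card = k := by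
  simp [chainsWithSup]

theorem sup_mem_of_isChain [DecidableEq α] {C : Finset (Finset α)} (hC : IsChain (· ⊆ ·) (C : Set (Finset α)))
    (hne : C.Nonempty) : C.sup id ∈ C := by
  obtain ⟨S, hS, hmax⟩ := C.exists_max_image Finset.card hne
  have : C.sup id = S := by
    refine le_antisymm (Finset.sup_le fun T hT => ?_) (Finset.le_sup (f := id) hS)
    rcases hC.total hT hS with h | h
    · exact h
    · exact (Finset.eq_of_subset_of_card_le h (hmax T hT)).ge
  rwa [this]

theorem erase_mem_chainsWithSup [Fintype α] [DecidableEq α] {A : Finset α} {k : ℕ} {C : Finset (Finset α)}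
    (h : C ∈ chainsWithSup A (k + 1)) :
    A ∈ C ∧ (C.erase A).sup id ⊂ A ∧ C.erase A ∈ chainsWithSup ((C.erase A).sup id) k := by
  rw [mem_chainsWithSup] at h
  obtain ⟨hC, h0, hA, hk⟩ := h
  have hne : C.Nonempty := Finset.card_pos.1 (by omega)
  have hAC : A ∈ C := hA ▸ sup_mem_of_isChain hC hne
  have hC' : IsChain (· ⊆ ·) ((C.erase A : Finset (Finset α)) : Set (Finset α)) :=
    hC.mono (by simp)
  have h0' : ∅ ∉ C.erase A := fun h => h0 (Finset.mem_of_mem_erase h)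
  refine ⟨hAC, Finset.ssubset_iff_subset_ne.2 ⟨?_, ?_⟩, ?_⟩
  · exact (Finset.sup_mono (Finset.erase_subset _ _)).trans hA.le
  · rcases Finset.eq_empty_or_nonempty (C.erase A) with h | h
    · rw [h]
      rintro rfl
      exact h0 hAC
    · intro he
      have := sup_mem_of_isChain hC' h
      rw [he] at this
      simp at this
  · exact mem_chainsWithSup.2 ⟨hC', h0', rfl, by rw [Finset.card_erase_of_mem hAC, hk]; rfl⟩

theorem insert_mem_chainsWithSup [Fintype α] [DecidableEq α] {A B : Finset α} {k : ℕ} {C : Finset (Finset α)}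
    (hB : B ⊂ A) (h : C ∈ chainsWithSup B k) :
    A ∉ C ∧ insert A C ∈ chainsWithSup A (k + 1) := by
  rw [mem_chainsWithSup] at h
  obtain ⟨hC, h0, hB', hk⟩ := h
  have hsub : ∀ S ∈ C, S ⊆ B := fun S hS => hB' ▸ Finset.le_sup (f := id) hS
  have hAC : A ∉ C := fun hA => hB.2 (hsub A hA)
  refine ⟨hAC, mem_chainsWithSup.2 ⟨?_, ?_, ?_, ?_⟩⟩
  · rw [Finset.coe_insert]
    exact hC.insert fun S hS _ => Or.inr ((hsub S hS).trans hB.1)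
  · rw [Finset.mem_insert, not_or]
    refine ⟨?_, h0⟩
    rintro rfl
    exact hB.2 (Finset.empty_subset _)
  · rw [Finset.sup_insert, hB']
    exact sup_eq_left.2 hB.1
  · rw [Finset.card_insert_of_notMem hAC, hk]

/-- The union `A` is itself the top member; removing it leaves a chain with a smaller union `B`,
possibly empty. -/
theorem card_chainsWithSup_succ [Fintype α] [DecidableEq α] (A : Finset α) (k : ℕ) :
    (chainsWithSup A (k + 1)).card = ∑ B ∈ A.ssubsets, (chainsWithSup B k).card := by
  rw [← Finset.card_sigma]
  refine Finset.card_bij' (fun C _ => ⟨(C.erase A).sup id, C.erase A⟩)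
    (fun p _ => insert A p.2) ?_ ?_ ?_ ?_
  · intro C hC
    have := erase_mem_chainsWithSup hC
    simp only [Finset.mem_sigma, Finset.mem_ssubsets]
    exact this.2
  · rintro ⟨B, C⟩ h
    simp only [Finset.mem_sigma, Finset.mem_ssubsets] at h
    exact (insert_mem_chainsWithSup h.1 h.2).2
  · intro C hC
    exact Finset.insert_erase (erase_mem_chainsWithSup hC).1
  · rintro ⟨B, C⟩ h
    simp only [Finset.mem_sigma, Finset.mem_ssubsets] at h
    have h1 := (insert_mem_chainsWithSup h.1 h.2).1
    have h2 := (mem_chainsWithSup.1 h.2).2.2.1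
    simp only [Finset.erase_insert h1]
    rw [h2]

theorem card_le_of_mem_chainsWithSup [Fintype α] [DecidableEq α] {A : Finset α} {k : ℕ} {C : Finset (Finset α)}
    (h : C ∈ chainsWithSup A k) : k ≤ A.card := by
  induction k generalizing A C with
  | zero => simp
  | succ k ih =>
    have := erase_mem_chainsWithSup h
    have h2 := Finset.card_lt_card this.2.1
    have h3 := ih this.2.2
    omega

theorem chainsWithSup_eq_empty [Fintype α] [DecidableEq α] {A : Finset α} {k : ℕ} (h : A.card < k) :
    chainsWithSup A k = ∅ := by
  refine Finset.eq_empty_of_forall_notMem fun C hC => ?_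
  have := card_le_of_mem_chainsWithSup hC
  omega

theorem chainsWithSup_empty_zero [Fintype α] [DecidableEq α] : chainsWithSup (∅ : Finset α) 0 = {∅} := by
  ext C
  rw [mem_chainsWithSup, Finset.mem_singleton, Finset.card_eq_zero]
  constructor
  · exact fun h => h.2.2.2
  · rintro rfl
    simp

theorem chainsWithSup_zero_of_nonempty [Fintype α] [DecidableEq α] {A : Finset α} (hA : A.Nonempty) :
    chainsWithSup A 0 = ∅ := by
  refine Finset.eq_empty_of_forall_notMem fun C hC => ?_
  obtain ⟨-, -, h, h0⟩ := mem_chainsWithSup.1 hC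
  rw [Finset.card_eq_zero] at h0
  subst h0
  simp at h
  simp [← h] at hA

theorem powersetCard_subset_ssubsets [DecidableEq α] {A : Finset α} {k : ℕ} (h : k < A.card) :
    A.powersetCard k ⊆ A.ssubsets := by
  intro B hB
  rw [Finset.mem_powersetCard] at hB
  rw [Finset.mem_ssubsets]
  refine Finset.ssubset_iff_subset_ne.2 ⟨hB.1, ?_⟩
  rintro rfl
  omega

theorem card_chainsWithSup_self [Fintype α] [DecidableEq α] {n : ℕ} {A : Finset α} (hA : A.card = n) :
    (chainsWithSup A n).card = n ! := by
  induction n generalizing A with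
  | zero =>
    rw [Finset.card_eq_zero] at hA
    subst hA
    simp [chainsWithSup_empty_zero]
  | succ n ih =>
    rw [card_chainsWithSup_succ, ← Finset.sum_subset
      (powersetCard_subset_ssubsets (k := n) (by omega))]
    · rw [Finset.sum_congr rfl fun B hB => ih (Finset.mem_powersetCard.1 hB).2,
        Finset.sum_const, Finset.card_powersetCard, hA, Nat.choose_succ_self_right,
        Nat.factorial_succ, smul_eq_mul]
    · intro B hB hB'
      rw [Finset.mem_ssubsets] at hB
      rw [Finset.mem_powersetCard, not_and] at hB'
      have h1 := Finset.card_lt_card hB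
      have h2 := hB' hB.1
      rw [chainsWithSup_eq_empty (by omega), Finset.card_empty]

/-- Below the top, either one element is dropped and the rest still lacks one member, or two are
dropped and the rest is saturated. Smaller `B` carry too few members. -/
theorem two_mul_card_chainsWithSup [Fintype α] [DecidableEq α] {n : ℕ} {A : Finset α} (hA : A.card = n + 1) :
    2 * (chainsWithSup A n).card = n * (n + 1)! := by
  induction n generalizing A with
  | zero => simp [chainsWithSup_zero_of_nonempty (Finset.card_pos.1 (by omega : 0 < A.card))]
  | succ n ih =>
    have hdisj : Disjoint (A.powersetCard (n + 1)) (A.powersetCard n) :=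
      Finset.disjoint_left.2 fun B h1 h2 => by
        rw [Finset.mem_powersetCard] at h1 h2
        omega
    rw [card_chainsWithSup_succ, ← Finset.sum_subset (Finset.union_subset
      (powersetCard_subset_ssubsets (A := A) (k := n + 1) (by omega))
      (powersetCard_subset_ssubsets (A := A) (k := n) (by omega))), Finset.sum_union hdisj,
      mul_add, Finset.mul_sum]
    · rw [Finset.sum_congr rfl fun B hB => ih (Finset.mem_powersetCard.1 hB).2,
        Finset.sum_congr (s₁ := A.powersetCard n) rfl
          fun B hB => card_chainsWithSup_self (Finset.mem_powersetCard.1 hB).2,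
        Finset.sum_const, Finset.sum_const, Finset.card_powersetCard, Finset.card_powersetCard,
        hA, Nat.choose_succ_self_right]
      have h := Nat.choose_mul_factorial_mul_factorial (n := n + 1 + 1) (k := n) (by omega)
      rw [show n + 1 + 1 - n = 2 by omega, Nat.factorial_two] at h
      rw [smul_eq_mul, smul_eq_mul]
      have e1 : (n + 1 + 1)! = (n + 2) * (n + 1)! := Nat.factorial_succ _
      linarith [congrArg (fun t => n * t) e1]
    · intro B hB hB'
      rw [Finset.mem_ssubsets] at hB
      rw [Finset.mem_union, Finset.mem_powersetCard, Finset.mem_powersetCard, not_or, not_and,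
        not_and] at hB'
      have h1 := Finset.card_lt_card hB
      have h2 := hB'.1 hB.1
      have h3 := hB'.2 hB.1
      rw [chainsWithSup_eq_empty (by omega), Finset.card_empty]

open Classical in
/-- The pairs `(C, Z)` of a chain `C` of non-empty sets and a set `Z` disjoint from them, with
one element less than the ground set in total. -/
noncomputable def edgePairs (α : Type*) [Fintype α] : Finset (Finset (Finset α) × Finset α) :=
  Finset.univ.filter fun p =>
    IsChain (· ⊆ ·) (p.1 : Set (Finset α)) ∧ ∅ ∉ p.1 ∧ (∀ S ∈ p.1, Disjoint S p.2) ∧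
      p.1.card + p.2.card + 1 = Fintype.card α

theorem mem_edgePairs [Fintype α] {p : Finset (Finset α) × Finset α} :
    p ∈ edgePairs α ↔ IsChain (· ⊆ ·) (p.1 : Set (Finset α)) ∧ ∅ ∉ p.1 ∧
      (∀ S ∈ p.1, Disjoint S p.2) ∧ p.1.card + p.2.card + 1 = Fintype.card α := by
  simp [edgePairs]

theorem mem_edgePairs_iff [Fintype α] [DecidableEq α] {p : Finset (Finset α) × Finset α} :
    p ∈ edgePairs α ↔ p.1 ∈ chainsWithSup (p.1.sup id) p.1.card ∧ p.2 ⊆ (p.1.sup id)ᶜ ∧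
      p.1.card + p.2.card + 1 = Fintype.card α := by
  rw [mem_edgePairs, mem_chainsWithSup]
  have : (∀ S ∈ p.1, Disjoint S p.2) ↔ p.2 ⊆ (p.1.sup id)ᶜ := by
    rw [Finset.subset_compl_iff_disjoint_right, disjoint_comm, Finset.disjoint_sup_left]
    rfl
  rw [this]
  tauto

/-- Since `|C| ≤ |A|` and `|Z| ≤ |Aᶜ|`, exactly one of the two falls short, by one. The case `A = ∅`
is split off because `0 - 1 = 0` would count the empty chain again. -/
theorem card_edgePairs_eq_sum [Fintype α] [DecidableEq α] : (edgePairs α).card =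
    ∑ A : Finset α, ((chainsWithSup A A.card).card * Aᶜ.card +
      if A = ∅ then 0 else (chainsWithSup A (A.card - 1)).card) := by
  classical
  have hfib := Finset.card_eq_sum_card_fiberwise (s := edgePairs α) (t := Finset.univ)
    (f := fun p => p.1.sup id) (fun _ _ => Finset.mem_univ _)
  rw [hfib]
  refine Finset.sum_congr rfl fun A _ => ?_
  have hcompl : Aᶜ.card + A.card = Fintype.card α := by
    rw [add_comm]; exact Finset.card_add_card_compl A
  rw [show ((edgePairs α).filter fun p => p.1.sup id = A) =
      (chainsWithSup A A.card ×ˢ (Aᶜ.powerset.filter fun Z => Z.card + 1 = Aᶜ.card)) ∪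
      ((if A = ∅ then ∅ else chainsWithSup A (A.card - 1)) ×ˢ {Aᶜ}) from ?_,
    Finset.card_union_of_disjoint, Finset.card_product, Finset.card_product]
  · congr 1
    · congr 1
      rcases Nat.eq_zero_or_pos Aᶜ.card with h | h
      · rw [h]
        simp
      · have : (Aᶜ.powerset.filter fun Z => Z.card + 1 = Aᶜ.card) =
            Aᶜ.powersetCard (Aᶜ.card - 1) := by
          ext Z
          simp only [Finset.mem_filter, Finset.mem_powerset, Finset.mem_powersetCard]
          refine and_congr_right fun _ => ?_
          omega
        rw [this, Finset.card_powersetCard]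
        obtain ⟨m, hm⟩ : ∃ m, Aᶜ.card = m + 1 := ⟨_, (Nat.succ_pred_eq_of_pos h).symm⟩
        rw [hm, Nat.add_sub_cancel, Nat.choose_succ_self_right]
    · split_ifs <;> simp
  · refine Finset.disjoint_left.2 fun p h1 h2 => ?_
    simp only [Finset.mem_product, Finset.mem_filter, Finset.mem_singleton] at h1 h2
    rw [h2.2] at h1
    omega
  · ext p
    simp only [Finset.mem_filter, Finset.mem_union, Finset.mem_product, Finset.mem_powerset,
      Finset.mem_singleton, mem_edgePairs_iff]
    constructor
    · rintro ⟨⟨h1, h2, h3⟩, rfl⟩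
      have h4 := card_le_of_mem_chainsWithSup h1
      have h5 := Finset.card_le_card h2
      rcases h4.eq_or_lt with h | h
      · left
        exact ⟨h ▸ h1, h2, by omega⟩
      · right
        have h6 : p.1.card = (p.1.sup id).card - 1 := by omega
        refine ⟨?_, Finset.eq_of_subset_of_card_le h2 (by omega)⟩
        rw [if_neg (fun h0 => by rw [h0] at h; simp at h), ← h6]
        exact h1
    · rintro (⟨h1, h2, h3⟩ | ⟨h1, h2⟩)
      · obtain ⟨-, -, h4, h5⟩ := mem_chainsWithSup.1 h1
        rw [h4, h5]
        exact ⟨⟨h1, h2, by omega⟩, rfl⟩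
      · split_ifs at h1 with hA
        · simp at h1
        obtain ⟨-, -, h4, h5⟩ := mem_chainsWithSup.1 h1
        have := Finset.card_pos.2 (Finset.nonempty_iff_ne_empty.2 hA)
        rw [h4, h5]
        exact ⟨⟨h1, h2.le, by rw [h2]; omega⟩, rfl⟩

theorem two_mul_card_edgePairs [Fintype α] [DecidableEq α] : 2 * (edgePairs α).card =
    Fintype.card α * ∑ k ∈ Finset.range (Fintype.card α + 1), (Fintype.card α).descFactorial k := by
  set M := Fintype.card α with hM
  -- At `A = ∅` the formula `(a - 1) a!` for twice the deficient chains reads `-1` instead of `0`,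
  -- hence the correction.
  have h1 : ∀ A : Finset α, (2 * ((chainsWithSup A A.card).card * Aᶜ.card +
      if A = ∅ then 0 else (chainsWithSup A (A.card - 1)).card) : ℤ) =
      A.card ! * (2 * M - A.card - 1) + if A = ∅ then 1 else 0 := by
    intro A
    have hc : (Aᶜ.card : ℤ) = M - A.card := by
      rw [Finset.card_compl, Nat.cast_sub (Finset.card_le_univ A)]
    rw [card_chainsWithSup_self rfl, hc]
    split_ifs with hA
    · subst hA
      simp
    · obtain ⟨n, hn⟩ : ∃ n, A.card = n + 1 := Nat.exists_eq_succ_of_ne_zero (by simpa using hA)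
      have := two_mul_card_chainsWithSup hn
      rw [hn, Nat.add_sub_cancel]
      have h2 : (2 * (chainsWithSup A n).card : ℤ) = n * (n + 1)! := by exact_mod_cast this
      rw [mul_add, h2]
      push_cast
      ring
  have h2 : (2 * (edgePairs α).card : ℤ) =
      ∑ k ∈ Finset.range (M + 1), (M.descFactorial k : ℤ) * (2 * M - k - 1) + 1 := by
    rw [card_edgePairs_eq_sum]
    push_cast
    rw [Finset.mul_sum]
    have h3 := Finset.sum_congr (s₁ := (Finset.univ : Finset (Finset α))) rfl fun A _ => h1 A
    push_cast at h3
    rw [h3, Finset.sum_add_distrib]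
    congr 1
    · rw [← Finset.powerset_univ, Finset.sum_powerset_apply_card
        (fun m => ((m ! : ℕ) : ℤ) * (2 * M - m - 1))]
      rw [Finset.card_univ]
      refine Finset.sum_congr rfl fun k _ => ?_
      rw [Nat.descFactorial_eq_factorial_mul_choose, nsmul_eq_mul]
      push_cast
      ring
    · simp
  -- Telescoping: each term is `M.descFactorial (k + 1) - M.descFactorial k`.
  have h4 : ∀ m : ℕ, ∑ k ∈ Finset.range m, (M.descFactorial k : ℤ) * (M - k - 1) + 1 =
      M.descFactorial m := by
    intro m
    induction m with
    | zero => simp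
    | succ m ih =>
      rw [Finset.sum_range_succ, add_right_comm, ih, Nat.descFactorial_succ]
      rcases le_or_gt m M with h | h
      · push_cast [Nat.cast_sub h]
        ring
      · rw [Nat.descFactorial_of_lt h]
        simp
  have h5 := h4 (M + 1)
  rw [Nat.descFactorial_of_lt (Nat.lt_succ_self M)] at h5
  have : (2 * (edgePairs α).card : ℤ) =
      M * ∑ k ∈ Finset.range (M + 1), (M.descFactorial k : ℤ) := by
    rw [h2, Finset.mul_sum, ← sub_eq_zero, add_sub_right_comm, ← Finset.sum_sub_distrib]
    rw [← Nat.cast_zero, ← h5]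
    congr 1
    refine Finset.sum_congr rfl fun k _ => ?_
    ring
  exact_mod_cast this

/-- The sum is `M!` times the exponential series cut after `1 / M!`. The remainder times `M!` is at
most `(M + 2) / (M + 1)²`, below `1` once `M ≥ 1`; at `M = 0` the floor is `2` and the sum `1`. -/
theorem floor_exp_one_mul_factorial {M : ℕ} (hM : 0 < M) :
    ⌊Real.exp 1 * (M ! : ℝ)⌋ = ((∑ k ∈ Finset.range (M + 1), M.descFactorial k : ℕ) : ℤ) := by
  have hsum : ((∑ k ∈ Finset.range (M + 1), M.descFactorial k : ℕ) : ℝ) =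
      (∑ m ∈ Finset.range (M + 1), (1 : ℝ) ^ m / m !) * M ! := by
    rw [← Finset.sum_range_reflect, Finset.sum_mul]
    push_cast
    refine Finset.sum_congr rfl fun k hk => ?_
    have hk' : k ≤ M := by simpa [Nat.lt_succ_iff] using hk
    have h := Nat.factorial_mul_descFactorial (n := M) (k := M - k) (by omega)
    rw [Nat.sub_sub_self hk'] at h
    rw [← h]
    push_cast
    have : (k ! : ℝ) ≠ 0 := by positivity
    field_simp
    simp
  have hlow : (∑ m ∈ Finset.range (M + 1), (1 : ℝ) ^ m / m !) ≤ Real.exp 1 :=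
    Real.sum_le_exp_of_nonneg zero_le_one _
  have hup := (abs_le.1 (Real.exp_bound (x := 1) (by simp) (Nat.succ_pos M))).2
  have hM0 : (0 : ℝ) < M ! := by positivity
  have hM1 : (1 : ℝ) ≤ M := by exact_mod_cast hM
  rw [Int.floor_eq_iff, Int.cast_natCast, hsum]
  refine ⟨by gcongr, ?_⟩
  have hb : (|1| : ℝ) ^ M.succ * (M.succ.succ / (M.succ ! * M.succ)) * M ! < 1 := by
    rw [Nat.factorial_succ]
    push_cast
    rw [abs_one, one_pow, one_mul, div_mul_eq_mul_div, div_lt_one (by positivity)]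
    have : (M : ℝ) + 1 + 1 < (M + 1) * (M + 1) := by nlinarith
    nlinarith [mul_lt_mul_of_pos_right this hM0]
  have h := mul_le_mul_of_nonneg_right hup hM0.le
  rw [sub_mul] at h
  have e : Finset.range M.succ = Finset.range (M + 1) := rfl
  rw [e] at h
  linarith

end Count

/-! ### Points with prescribed tight sets and zeros -/

section Vertex

variable {ι : Type*} [Fintype ι] [DecidableEq ι] {f : Finset ι → ℝ}

/-- A point whose support `A` is tight is extended by positive values on a block `B` disjoint
from `A`; the only set that may become tight is `A ∪ B`. -/
theorem IsStrictRank.exists_extension (hf : IsStrictRank f) {R : ι → ℝ} (hR : R ∈ polytope f)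
    {A B : Finset ι} (hz : zeros R = Aᶜ) (hA : ∑ i ∈ A, R i = f A) (hAB : Disjoint A B)
    (hB : B.Nonempty) {y : ι → ℝ} (hy : ∀ i ∈ B, 0 < y i)
    (hle : ∀ T ⊆ B, T.Nonempty → ∑ i ∈ T, y i ≤ f (A ∪ T) - f A)
    (hlt : ∀ T ⊂ B, T.Nonempty → ∑ i ∈ T, y i < f (A ∪ T) - f A) :
    ∃ Q ∈ polytope f, zeros Q = (A ∪ B)ᶜ ∧ ∀ S, S ∈ tightSets f Q ↔
      S ∈ tightSets f R ∨ S = A ∪ B ∧ ∑ i ∈ B, y i = f (A ∪ B) - f A := by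
  have hR0 : ∀ i, i ∉ A → R i = 0 := fun i hi => mem_zeros.1 (by simpa [hz] using hi)
  have hsum : ∀ S : Finset ι, (∑ i ∈ S, if i ∈ B then y i else R i) =
      ∑ i ∈ S ∩ A, R i + ∑ i ∈ S ∩ B, y i := by
    intro S
    rw [Finset.sum_ite, add_comm, Finset.filter_mem_eq_inter]
    congr 1
    symm
    refine Finset.sum_subset (fun i hi => ?_) fun i hi hi' => hR0 i fun h => hi' ?_
    · rw [Finset.mem_inter] at hi
      exact Finset.mem_filter.2 ⟨hi.1, Finset.disjoint_left.1 hAB hi.2⟩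
    · exact Finset.mem_inter.2 ⟨(Finset.mem_filter.1 hi).1, h⟩
  have hle' : ∀ T ⊆ B, ∑ i ∈ T, y i ≤ f (A ∪ T) - f A := by
    intro T hT
    rcases T.eq_empty_or_nonempty with rfl | h
    · simp
    · exact hle T hT h
  -- Submodularity for `S ∩ (A ∪ B)` and `A`. With `hmono` it bounds the new sum over `S` by `f S`,
  -- and tightness of `S` forces equality throughout.
  have hsub : ∀ S : Finset ι, f (S ∩ A) + (f (A ∪ (S ∩ B)) - f A) ≤ f (S ∩ (A ∪ B)) ∧
      (f (S ∩ A) + (f (A ∪ (S ∩ B)) - f A) = f (S ∩ (A ∪ B)) →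
        S ∩ (A ∪ B) ⊆ A ∨ A ⊆ S ∩ (A ∪ B)) := by
    intro S
    have e1 : S ∩ (A ∪ B) ∪ A = A ∪ (S ∩ B) := by ext; simp only [Finset.mem_union, Finset.mem_inter]; tauto
    have e2 : S ∩ (A ∪ B) ∩ A = S ∩ A := by ext; simp only [Finset.mem_union, Finset.mem_inter]; tauto
    by_cases h1 : S ∩ (A ∪ B) ⊆ A
    · rw [Finset.union_eq_right.2 h1] at e1
      rw [Finset.inter_eq_left.2 h1] at e2
      rw [← e1, ← e2]
      exact ⟨by linarith, fun _ => Or.inl h1⟩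
    · by_cases h2 : A ⊆ S ∩ (A ∪ B)
      · rw [Finset.union_eq_left.2 h2] at e1
        rw [Finset.inter_eq_right.2 h2] at e2
        rw [← e1, ← e2]
        exact ⟨by linarith, fun _ => Or.inr h2⟩
      · have := hf.submod _ _ h1 h2
        rw [e1, e2] at this
        exact ⟨by linarith, fun h => by linarith⟩
  have hmono : ∀ S : Finset ι, f (S ∩ (A ∪ B)) ≤ f S := fun S =>
    hf.strictMono.monotone Finset.inter_subset_left
  refine ⟨fun i => if i ∈ B then y i else R i, ⟨fun i => ?_, fun S => ?_⟩, ?_, fun S => ?_⟩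
  · dsimp only
    split_ifs with h
    · exact (hy i h).le
    · exact hR.1 i
  · rw [hsum]
    have h1 := hR.2 (S ∩ A)
    have h2 := hle' (S ∩ B) Finset.inter_subset_right
    linarith [(hsub S).1, hmono S]
  · ext i
    rw [mem_zeros, Finset.mem_compl, Finset.mem_union]
    split_ifs with h
    · simp [h, (hy i h).ne']
    · rw [← mem_zeros, hz]
      simp [h]
  · rw [mem_tightSets, hsum]
    constructor
    · rintro ⟨hne, heq⟩
      have h1 := hR.2 (S ∩ A)
      have h2 := hle' (S ∩ B) Finset.inter_subset_right
      have h3 := hsub S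
      have h4 := hmono S
      have e1 : S ∩ (A ∪ B) = S := by
        by_contra h
        have := hf.strictMono (Finset.ssubset_iff_subset_ne.2 ⟨Finset.inter_subset_left, h⟩)
        linarith [h3.1]
      have e2 : ∑ i ∈ S ∩ B, y i = f (A ∪ (S ∩ B)) - f A := by linarith [h3.1]
      have e3 : ∑ i ∈ S ∩ A, R i = f (S ∩ A) := by linarith [h3.1]
      rcases h3.2 (by linarith [h3.1]) with h | h
      · left
        rw [e1] at h
        rw [Finset.inter_eq_left.2 h] at e3
        exact mem_tightSets.2 ⟨hne, e3⟩
      · rw [e1] at h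
        rcases (S ∩ B).eq_empty_or_nonempty with h0 | h0
        · left
          have : S ⊆ A := by
            rw [← e1, Finset.inter_union_distrib_left, h0, Finset.union_empty]
            exact Finset.inter_subset_right
          rw [Finset.inter_eq_left.2 this] at e3
          exact mem_tightSets.2 ⟨hne, e3⟩
        · right
          have h5 : S ∩ B = B := by
            by_contra hn
            have := hlt _ (Finset.ssubset_iff_subset_ne.2 ⟨Finset.inter_subset_right, hn⟩) h0
            linarith
          rw [h5] at e2
          refine ⟨?_, e2⟩
          rw [← e1, Finset.inter_union_distrib_left, h5, Finset.inter_eq_right.2 h]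
    · rintro (hS | ⟨rfl, hyB⟩)
      · have hd := hf.disjoint_zeros hR hS
        rw [hz, ← Finset.subset_compl_iff_disjoint_right, compl_compl] at hd
        rw [mem_tightSets] at hS
        rw [Finset.inter_eq_left.2 hd,
          Finset.disjoint_iff_inter_eq_empty.1 (hAB.mono_left hd)]
        simpa using hS
      · rw [Finset.inter_eq_right.2 Finset.subset_union_left,
          Finset.inter_eq_right.2 Finset.subset_union_right, hA, hyB]
        exact ⟨hB.mono Finset.subset_union_right, by ring⟩

omit [Fintype ι] in
theorem IsStrictRank.lt_insert (hf : IsStrictRank f) {A : Finset ι} {x : ι} (hx : x ∉ A) :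
    f A < f (insert x A) :=
  hf.strictMono (Finset.ssubset_insert hx)

omit [Fintype ι] in
/-- Positive values on a block of at most two elements for which the whole block, and no other
non-empty subset, is tight over `A`. -/
theorem IsStrictRank.exists_block (hf : IsStrictRank f) {A B : Finset ι} (hAB : Disjoint A B)
    (hB : B.card = 1 ∨ B.card = 2) : ∃ y : ι → ℝ, (∀ i ∈ B, 0 < y i) ∧
      ∑ i ∈ B, y i = f (A ∪ B) - f A ∧
      ∀ T ⊂ B, T.Nonempty → ∑ i ∈ T, y i < f (A ∪ T) - f A := by
  rcases hB with hB | hB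
  · obtain ⟨x, rfl⟩ := Finset.card_eq_one.1 hB
    rw [Finset.disjoint_singleton_right] at hAB
    refine ⟨fun _ => f (A ∪ {x}) - f A, fun i _ => ?_, by simp, fun T hT hT0 => ?_⟩
    · have := hf.lt_insert hAB
      rw [Finset.union_comm, ← Finset.insert_eq]
      linarith
    · rw [Finset.ssubset_singleton_iff] at hT
      exact absurd hT hT0.ne_empty
  · obtain ⟨x, z, hxz, rfl⟩ := Finset.card_eq_two.1 hB
    rw [Finset.disjoint_insert_right, Finset.disjoint_singleton_right] at hAB
    have ex : A ∪ {x} = insert x A := by rw [Finset.union_comm, Finset.insert_eq]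
    have ez : A ∪ {z} = insert z A := by rw [Finset.union_comm, Finset.insert_eq]
    have exz : A ∪ {x, z} = insert x (insert z A) := by
      ext; simp only [Finset.mem_union, Finset.mem_insert, Finset.mem_singleton]; tauto
    have exz' : A ∪ {x, z} = insert z (insert x A) := by
      ext; simp only [Finset.mem_union, Finset.mem_insert, Finset.mem_singleton]; tauto
    have h1 : f (insert z A) < f (A ∪ {x, z}) := exz ▸ hf.lt_insert (by simp [hxz, hAB.1])
    have h2 : f (insert x A) < f (A ∪ {x, z}) := exz' ▸ hf.lt_insert (by simp [hxz.symm, hAB.2])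
    have h3 := hf.submod (insert x A) (insert z A)
      (fun h => by simpa [hxz, hAB.1] using h (Finset.mem_insert_self _ _))
      (fun h => by simpa [hxz.symm, hAB.2] using h (Finset.mem_insert_self _ _))
    rw [show insert x A ∪ insert z A = A ∪ {x, z} by
      ext; simp only [Finset.mem_union, Finset.mem_insert, Finset.mem_singleton]; tauto,
      show insert x A ∩ insert z A = A by
        ext i; simp only [Finset.mem_inter, Finset.mem_insert]; grind] at h3
    set a := f (insert x A)
    set b := f (insert z A)
    set c := f (A ∪ {x, z})
    -- These values add up to `c - f A` and leave both singletons the same slack `(a + b - c - f A)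
    -- / 2`, positive by `h3`.
    refine ⟨fun i => if i = x then (a + c - b - f A) / 2 else (b + c - a - f A) / 2,
      ?_, ?_, fun T hT hT0 => ?_⟩
    · have h4 := hf.lt_insert hAB.1
      have h5 := hf.lt_insert hAB.2
      intro i hi
      dsimp only
      split_ifs <;> linarith
    · rw [Finset.sum_pair hxz, if_pos rfl, if_neg hxz.symm]
      ring
    · have hcard := Finset.card_lt_card hT
      rw [hB] at hcard
      have hpos := hT0.card_pos
      obtain ⟨w, rfl⟩ := Finset.card_eq_one.1 (by omega : T.card = 1)
      have hw := hT.1 (Finset.mem_singleton_self w)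
      rw [Finset.mem_insert, Finset.mem_singleton] at hw
      rw [Finset.sum_singleton]
      rcases hw with rfl | rfl
      · rw [if_pos rfl, ex]
        linarith
      · rw [if_neg hxz.symm, ez]
        linarith

omit [Fintype ι] in
theorem zero_mem_polytope (hf : IsStrictRank f) : (0 : ι → ℝ) ∈ polytope f := by
  refine ⟨fun _ => le_rfl, fun S => ?_⟩
  simpa [hf.empty] using hf.strictMono.monotone (Finset.empty_subset S)

/-- The point is built block by block up the chain; `hk` ensures that the difference of consecutive
members has at most two elements, as `exists_block` requires. -/
theorem IsStrictRank.exists_point_of_chain (hf : IsStrictRank f) {k : ℕ} {A : Finset ι}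
    {C : Finset (Finset ι)} (hC : C ∈ chainsWithSup A k) (hk : A.card ≤ k + 1) :
    ∃ R ∈ polytope f, zeros R = Aᶜ ∧ tightSets f R = C := by
  induction k generalizing A C with
  | zero =>
    have hA : A = ∅ := by
      by_contra h
      rw [chainsWithSup_zero_of_nonempty (Finset.nonempty_iff_ne_empty.2 h)] at hC
      simp at hC
    subst hA
    rw [chainsWithSup_empty_zero, Finset.mem_singleton] at hC
    subst hC
    refine ⟨0, zero_mem_polytope hf, ?_, ?_⟩
    · ext i
      simp [mem_zeros]
    · refine Finset.eq_empty_of_forall_notMem fun S hS => ?_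
      obtain ⟨hne, h⟩ := mem_tightSets.1 hS
      have := hf.strictMono (Finset.empty_ssubset.2 hne)
      simp [← h, hf.empty] at this
  | succ k ih =>
    obtain ⟨hAC, hlt, hmem⟩ := erase_mem_chainsWithSup hC
    set B := (C.erase A).sup id
    have hcard := Finset.card_lt_card hlt
    have hcard' := card_le_of_mem_chainsWithSup hmem
    obtain ⟨R, hR, hz, ht⟩ := ih hmem (by omega)
    have hB : ∑ i ∈ B, R i = f B := by
      rcases (C.erase A).eq_empty_or_nonempty with h | h
      · have : B = ∅ := by simp [B, h]
        simp [this, hf.empty]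
      · have := sup_mem_of_isChain (mem_chainsWithSup.1 hmem).1 h
        exact (mem_tightSets.1 (ht.symm ▸ this : B ∈ tightSets f R)).2
    have hd : Disjoint B (A \ B) := Finset.disjoint_sdiff
    have hcd := Finset.card_sdiff_of_subset hlt.1
    obtain ⟨y, hy, hyB, hyT⟩ := hf.exists_block hd (by omega)
    have hun : B ∪ A \ B = A := Finset.union_sdiff_of_subset hlt.1
    obtain ⟨Q, hQ, hQz, hQt⟩ := hf.exists_extension hR hz hB hd
      (Finset.card_pos.1 (by omega)) hy (fun T hT hT0 => by
        rcases eq_or_ne T (A \ B) with rfl | hne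
        · exact hyB.le
        · exact (hyT T (Finset.ssubset_iff_subset_ne.2 ⟨hT, hne⟩) hT0).le) hyT
    rw [hun] at hQz hQt
    refine ⟨Q, hQ, hQz, ?_⟩
    ext S
    rw [hun] at hyB
    rw [hQt, ht]
    simp only [hyB, and_true, Finset.mem_erase]
    by_cases hS : S = A
    · simp [hS, hAC]
    · simp [hS]

theorem IsStrictRank.exists_point_of_mem_edgePairs (hf : IsStrictRank f)
    {p : Finset (Finset ι) × Finset ι} (hp : p ∈ edgePairs ι) :
    ∃ R ∈ polytope f, tightSets f R = p.1 ∧ zeros R = p.2 := by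
  obtain ⟨C, Z⟩ := p
  obtain ⟨hC, hZ, hcard⟩ := mem_edgePairs_iff.1 hp
  simp only at hC hZ hcard ⊢
  set A := C.sup id with hAdef
  have h1 := card_le_of_mem_chainsWithSup hC
  have h2 := Finset.card_le_card hZ
  have h3 := Finset.card_add_card_compl A
  obtain ⟨R, hR, hz, ht⟩ := hf.exists_point_of_chain hC (by omega)
  -- If `Z ≠ Aᶜ`, the cardinalities leave exactly one element `x` outside `A` and `Z`. Giving it
  -- half of the available increment makes it positive without a new tight set.
  by_cases hZA : Z = Aᶜ
  · exact ⟨R, hR, ht, by rw [hz, hZA]⟩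
  have h4 := Finset.card_lt_card (Finset.ssubset_iff_subset_ne.2 ⟨hZ, hZA⟩)
  obtain ⟨x, hx⟩ := Finset.card_eq_one.1
    (by rw [Finset.card_sdiff_of_subset hZ]; omega : (Aᶜ \ Z).card = 1)
  have hxA : x ∉ A := by
    have : x ∈ Aᶜ \ Z := hx ▸ Finset.mem_singleton_self x
    exact Finset.mem_compl.1 (Finset.mem_sdiff.1 this).1
  have hA : ∑ i ∈ A, R i = f A := by
    rcases C.eq_empty_or_nonempty with h | h
    · have : A = ∅ := by simp [hAdef, h]
      simp [this, hf.empty]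
    · have := sup_mem_of_isChain (mem_chainsWithSup.1 hC).1 h
      exact (mem_tightSets.1 (ht.symm ▸ this : A ∈ tightSets f R)).2
  have hlt := hf.lt_insert hxA
  have ex : A ∪ {x} = insert x A := by rw [Finset.union_comm, Finset.insert_eq]
  obtain ⟨Q, hQ, hQz, hQt⟩ := hf.exists_extension (B := {x}) hR hz hA (by simpa using hxA)
    (Finset.singleton_nonempty x) (y := fun _ => (f (insert x A) - f A) / 2)
    (fun _ _ => by linarith)
    (fun T hT hT0 => by
      rw [(Finset.subset_singleton_iff.1 hT).resolve_left hT0.ne_empty, Finset.sum_singleton, ex]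
      linarith)
    (fun T hT hT0 => absurd (Finset.ssubset_singleton_iff.1 hT) hT0.ne_empty)
  refine ⟨Q, hQ, ?_, ?_⟩
  · ext S
    rw [hQt, ht, ex, Finset.sum_singleton]
    refine or_iff_left fun h => ?_
    linarith [h.2]
  · rw [hQz, Finset.compl_union, ← Finset.sdiff_eq_inter_compl, ← hx,
      Finset.sdiff_sdiff_eq_self hZ]

end Vertex

/-! ### Edges correspond to pairs -/

section Edges

variable {M : ℕ} {f : Finset (Fin M) → ℝ}

theorem IsStrictRank.setOf_isEdge_eq (hf : IsStrictRank f) :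
    {F | IsEdge (polytope f) F} =
      (fun p : Finset (Finset (Fin M)) × Finset (Fin M) => faceOf f p.1 p.2) ''
        (edgePairs (Fin M) : Set _) := by
  ext F
  constructor
  · rintro ⟨hF, hdim⟩
    rcases F.eq_empty_or_nonempty with rfl | hne
    · have h0 : (affineSpan ℝ (∅ : Set (Fin M → ℝ))).direction = ⊥ := by
        rw [AffineSubspace.span_empty, AffineSubspace.direction_bot]
      rw [h0, finrank_bot] at hdim
      exact absurd hdim zero_ne_one
    obtain ⟨R, hR, rfl⟩ := hF.exists_eq_faceOf hne
    refine ⟨(tightSets f R, zeros R), ?_, rfl⟩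
    have hC := hf.isChain_tightSets hR
    have h0 : ∅ ∉ tightSets f R := by simp [mem_tightSets]
    have hZ : ∀ S ∈ tightSets f R, Disjoint S (zeros R) := fun S => hf.disjoint_zeros hR
    rw [direction_affineSpan_faceOf hR] at hdim
    have := finrank_faceDirection hC h0 hZ
    rw [hdim] at this
    exact mem_edgePairs.2 ⟨hC, h0, hZ, this⟩
  · rintro ⟨p, hp, rfl⟩
    refine ⟨isFace_faceOf f _ _, ?_⟩
    obtain ⟨R, hR, ht, hz⟩ := hf.exists_point_of_mem_edgePairs hp
    obtain ⟨hC, h0, hZ, hcard⟩ := mem_edgePairs.1 hp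
    have := finrank_faceDirection hC h0 hZ
    have hdir : (affineSpan ℝ (faceOf f p.1 p.2)).direction = faceDirection p.1 p.2 := by
      rw [← ht, ← hz, direction_affineSpan_faceOf hR]
    change Module.finrank ℝ (affineSpan ℝ (faceOf f p.1 p.2)).direction = 1
    rw [hdir]
    omega

/-- A point whose tight data are exactly `p` lies in the face of `q` only if the constraints of `q`
are among those of `p`. -/
theorem IsStrictRank.injOn_faceOf (hf : IsStrictRank f) :
    Set.InjOn (fun p : Finset (Finset (Fin M)) × Finset (Fin M) => faceOf f p.1 p.2)
      (edgePairs (Fin M) : Set _) := by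
  have key : ∀ p ∈ edgePairs (Fin M), ∀ q ∈ edgePairs (Fin M),
      faceOf f p.1 p.2 = faceOf f q.1 q.2 → q.1 ⊆ p.1 ∧ q.2 ⊆ p.2 := by
    intro p hp q hq h
    obtain ⟨R, hR, ht, hz⟩ := hf.exists_point_of_mem_edgePairs hp
    have hRp := mem_faceOf_self hR
    rw [ht, hz, h] at hRp
    have hne : ∀ S ∈ q.1, S.Nonempty := fun S hS =>
      Finset.nonempty_iff_ne_empty.2 fun h0 => (mem_edgePairs.1 hq).2.1 (h0 ▸ hS)
    rw [← ht, ← hz]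
    exact ⟨fun S hS => mem_tightSets.2 ⟨hne S hS, hRp.2.1 S hS⟩,
      fun i hi => mem_zeros.2 (hRp.2.2 i hi)⟩
  intro p hp q hq h
  have h1 := key p hp q hq h
  have h2 := key q hq p hp h.symm
  exact Prod.ext (h2.1.antisymm h1.1) (h2.2.antisymm h1.2)

end Edges

end MAC

theorem mainTheorem9 {M : ℕ} {X : Fin M → Type*} {Y : Type*}
    [∀ i, Fintype (X i)] [Fintype Y]
    (W : (∀ i, X i) → stdSimplex ℝ Y) (P : ∀ i, stdSimplex ℝ (X i))
    (hR : MAC.NonDegenerated W P) :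
    {F : Set (Fin M → ℝ) | MAC.IsEdge (MAC.region W P) F}.Finite ∧
      ({F : Set (Fin M → ℝ) | MAC.IsEdge (MAC.region W P) F}.ncard : ℝ) =
        (M : ℝ) / 2 * ((⌊Real.exp 1 * (M ! : ℝ)⌋ : ℤ) : ℝ) := by
  have hf := hR.isStrictRank
  have hE : {F : Set (Fin M → ℝ) | MAC.IsEdge (MAC.region W P) F} = _ := hf.setOf_isEdge_eq
  rw [hE]
  refine ⟨(Finset.finite_toSet _).image _, ?_⟩
  rw [hf.injOn_faceOf.ncard_image, Set.ncard_coe_finset]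
  have h := MAC.two_mul_card_edgePairs (α := Fin M)
  rw [Fintype.card_fin] at h
  -- For `M = 0` the floor identity fails, but the factor `M` makes both sides vanish.
  rcases Nat.eq_zero_or_pos M with h0 | hM
  · subst h0
    rw [zero_mul, mul_eq_zero] at h
    simp [h.resolve_left two_ne_zero]
  · rw [MAC.floor_exp_one_mul_factorial hM, Int.cast_natCast]
    have h' := congrArg (Nat.cast (R := ℝ)) h
    rw [Nat.cast_mul, Nat.cast_mul] at h'
    push_cast at h' ⊢
    linarith
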